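/- Let $C$ be an algebraically closed field of characteristic zero, and let $C(x)[D]$ be the ring of linear differential operators with coefficients in $C(x)$, where $Da=aD+a'$ for $a\in C(x)$ and ${}'=d/dx$. An operator $P=p_0+\dots+p_rD^r$ with $p_r\neq 0$ has order $\operatorname{ord}(P)=r$. It acts on every differential ring extension $F$ of $C(x)$ by $P\cdot f=\sum_i p_if^{(i)}$, and $f$ is called a solution of $P$ if $P\cdot f=0$. Write $V(P)$ for the $C$-vector space of solutions of $P$ in the field of formal Laurent series $C((x))$. The point $0$ is a singularity of $P$ if it is a pole of one of $p_0/p_r,\dots,p_{r-1}/p_r$, and an ordinary point otherwise; a singularity $0$ is called apparent if the solutions of $P$ in $C[[x]]$ form a space of dimension $r$ over $C$. An operator $A$ is a right factor of $B$ if $B=RA$ for some $R\in C(x)[D]$. The symmetric product $L\otimes Q$ of nonzero operators is the primitive nonzero operator (coprime polynomial coefficients; unique up to a nonzero constant factor) of lowest order such that $fg$ is a solution of $L\otimes Q$ whenever $f$ is a solution of $L$ and $g$ is a solution of $Q$ in a common differential ring extension of $C(x)$. For a $C$-subspace $V$ and a subset $U$ of $C((x))$, the colon space is $(V:U)=\{h\in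 C((x))\mid hU\subseteq V\}$. Let $L,M\in C(x)[D]$ be of positive order, and let $Q\in C(x)[D]$ be a nonzero operator such that $L\otimes Q$ is a right factor of $M$. If $0$ is an ordinary point of both $L$ and $M$, then 1. $0$ is either an ordinary point or an apparent singularity of $Q$; 2. $V(Q)\subseteq (V(M):V(L))$; 3. $\operatorname{ord}(Q)=\dim_C V(Q)\leq \dim_C\,(V(M):V(L))$. -/

import Mathlib

open scoped LaurentSeries

/-- The differential ring structure on a commutative ring given by an additive map `d` that
satisfies the Leibniz rule. -/
abbrev differentialOfLeibniz {R : Type*} [CommRing R] (d : R →+ R)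
    (h : ∀ a b, d (a * b) = a * d b + b * d a) : Differential R where
  deriv := Derivation.mk' d.toIntLinearMap (fun a b => by simpa using h a b)

theorem differential_deriv_mul {R : Type*} [CommRing R] [Differential R] (a b : R) :
    Differential.deriv (a * b) = a * Differential.deriv b + b * Differential.deriv a := by
  simp

/-! ### The derivation `d/dx` on the field `C(x)` -/

section RationalFunctions

variable {C : Type*} [Field C]

/-- The formal derivative `d/dx` on `C(x)`, by the quotient rule applied to the reduced fraction. -/
noncomputable def ratDeriv (f : RatFunc C) : RatFunc C :=
  algebraMap (Polynomial C) (RatFunc C)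
      (Polynomial.derivative f.num * f.denom - f.num * Polynomial.derivative f.denom) /
    algebraMap (Polynomial C) (RatFunc C) f.denom ^ 2

/-- The quotient rule holds for every representation of a rational function as a fraction. -/
theorem ratDeriv_div (p q : Polynomial C) (hq : q ≠ 0) :
    ratDeriv (algebraMap (Polynomial C) (RatFunc C) p / algebraMap (Polynomial C) (RatFunc C) q) =
      algebraMap (Polynomial C) (RatFunc C)
        (Polynomial.derivative p * q - p * Polynomial.derivative q) /
        algebraMap (Polynomial C) (RatFunc C) q ^ 2 := by
  set f := algebraMap (Polynomial C) (RatFunc C) p / algebraMap (Polynomial C) (RatFunc C) q with hf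
  have key : f.num * q = p * f.denom := (RatFunc.num_mul_eq_mul_denom_iff hq).2 hf
  have key' := congrArg Polynomial.derivative key
  simp only [Polynomial.derivative_mul] at key'
  unfold ratDeriv
  rw [div_eq_div_iff (pow_ne_zero 2 (RatFunc.algebraMap_ne_zero f.denom_ne_zero))
    (pow_ne_zero 2 (RatFunc.algebraMap_ne_zero hq)), ← map_pow, ← map_pow, ← map_mul, ← map_mul]
  congr 1
  linear_combination f.denom * q * key' -
    (Polynomial.derivative f.denom * q + Polynomial.derivative q * f.denom) * key

theorem exists_frac (f : RatFunc C) : ∃ p q : Polynomial C, q ≠ 0 ∧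
    f = algebraMap (Polynomial C) (RatFunc C) p / algebraMap (Polynomial C) (RatFunc C) q :=
  ⟨f.num, f.denom, f.denom_ne_zero, (RatFunc.num_div_denom f).symm⟩

theorem ratDeriv_add (f g : RatFunc C) : ratDeriv (f + g) = ratDeriv f + ratDeriv g := by
  obtain ⟨p, q, hq, rfl⟩ := exists_frac f
  obtain ⟨r, s, hs, rfl⟩ := exists_frac g
  have hq' := RatFunc.algebraMap_ne_zero hq
  have hs' := RatFunc.algebraMap_ne_zero hs
  rw [div_add_div _ _ hq' hs', ← map_mul, ← map_mul, ← map_mul, ← map_add,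
    ratDeriv_div _ _ (mul_ne_zero hq hs), ratDeriv_div _ _ hq, ratDeriv_div _ _ hs]
  simp only [Polynomial.derivative_mul, map_add, map_sub, map_mul]
  field_simp
  ring

theorem ratDeriv_mul (f g : RatFunc C) :
    ratDeriv (f * g) = f * ratDeriv g + g * ratDeriv f := by
  obtain ⟨p, q, hq, rfl⟩ := exists_frac f
  obtain ⟨r, s, hs, rfl⟩ := exists_frac g
  have hq' := RatFunc.algebraMap_ne_zero hq
  have hs' := RatFunc.algebraMap_ne_zero hs
  rw [div_mul_div_comm, ← map_mul, ← map_mul,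
    ratDeriv_div _ _ (mul_ne_zero hq hs), ratDeriv_div _ _ hq, ratDeriv_div _ _ hs]
  simp only [Polynomial.derivative_mul, map_add, map_sub, map_mul]
  field_simp
  ring

theorem ratDeriv_algebraMap (p : Polynomial C) :
    ratDeriv (algebraMap (Polynomial C) (RatFunc C) p) =
      algebraMap (Polynomial C) (RatFunc C) (Polynomial.derivative p) := by
  have h := ratDeriv_div p 1 one_ne_zero
  simpa using h

/-- `C(x)` as a differential field, with the derivation `d/dx`. -/
noncomputable instance instDifferentialRatFunc : Differential (RatFunc C) :=
  differentialOfLeibniz (AddMonoidHom.mk' ratDeriv ratDeriv_add) ratDeriv_mul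

theorem ratFunc_deriv_eq (f : RatFunc C) : Differential.deriv f = ratDeriv f := rfl

end RationalFunctions

/-! ### The derivation `d/dx` on the field `C((x))` -/

section Laurent

variable {C : Type*} [Field C]

theorem laurent_derivative_mul (f g : C⸨X⸩) :
    LaurentSeries.derivative C (f * g) =
      f * LaurentSeries.derivative C g + g * LaurentSeries.derivative C f := by
  -- the Euler operator `x d/dx`
  have euler : ∀ h : C⸨X⸩, ∀ n : ℤ,
      (HahnSeries.single 1 1 * LaurentSeries.derivative C h : C⸨X⸩).coeff n = (n : C) * h.coeff n := by
    intro h n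
    rw [HahnSeries.coeff_single_mul]
    simp
  have hx : (HahnSeries.single 1 1 : C⸨X⸩) ≠ 0 := by simp
  apply mul_left_cancel₀ hx
  have hs : ∀ h : C⸨X⸩,
      (HahnSeries.single 1 1 * LaurentSeries.derivative C h : C⸨X⸩).support ⊆ h.support := by
    intro h n hn hn'
    apply hn
    rw [euler, hn', mul_zero]
  have e : (HahnSeries.single 1 1 : C⸨X⸩) *
        (f * LaurentSeries.derivative C g + g * LaurentSeries.derivative C f) =
      f * (HahnSeries.single 1 1 * LaurentSeries.derivative C g) +
        (HahnSeries.single 1 1 * LaurentSeries.derivative C f) * g := by ring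
  rw [e]
  ext n
  rw [euler, HahnSeries.coeff_add, HahnSeries.coeff_mul,
    HahnSeries.coeff_mul_right' g.isPWO_support (hs g),
    HahnSeries.coeff_mul_left' f.isPWO_support (hs f), Finset.mul_sum, ← Finset.sum_add_distrib]
  refine Finset.sum_congr rfl fun ij hij => ?_
  have hn : ij.1 + ij.2 = n := (Finset.mem_antidiagonal.1 hij).2.2
  rw [euler, euler, ← hn]
  push_cast
  ring

/-- `C((x))` as a differential field, with the termwise derivation `d/dx`. -/
noncomputable instance instDifferentialLaurent : Differential C⸨X⸩ :=
  differentialOfLeibniz (LaurentSeries.derivative C).toAddMonoidHom laurent_derivative_mul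

theorem laurent_deriv_eq (f : C⸨X⸩) : Differential.deriv f = LaurentSeries.derivative C f := rfl

/-- `C((x))` as an extension of `C(x)`, by expanding rational functions into Laurent series. -/
noncomputable instance instAlgebraRatFuncLaurent : Algebra (RatFunc C) C⸨X⸩ :=
  RatFunc.liftAlgebra C C⸨X⸩

theorem laurent_monomial (n : ℕ) (a : C) :
    algebraMap (RatFunc C) C⸨X⸩ (algebraMap (Polynomial C) (RatFunc C) (Polynomial.monomial n a)) =
      HahnSeries.single (n : ℤ) a := by
  have h := RatFunc.coe_coe (Polynomial.monomial n a)
  refine h.symm.trans ?_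
  rw [← Polynomial.C_mul_X_pow_eq_monomial, Polynomial.coe_mul, Polynomial.coe_pow,
    Polynomial.coe_C, Polynomial.coe_X, map_mul, HahnSeries.ofPowerSeries_C,
    HahnSeries.ofPowerSeries_X_pow, HahnSeries.C_apply, HahnSeries.single_mul_single]
  simp

instance instIsScalarTowerRatFuncLaurent : IsScalarTower C (RatFunc C) C⸨X⸩ where
  smul_assoc c r f := by
    have h := laurent_monomial 0 c
    rw [Algebra.smul_def, Algebra.smul_def, Algebra.smul_def,
      IsScalarTower.algebraMap_apply C (Polynomial C) (RatFunc C), map_mul, mul_assoc,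
      Polynomial.algebraMap_eq, ← Polynomial.monomial_zero_left, h]
    simp

instance instIsScalarTowerLaurentLaurent : IsScalarTower C C⸨X⸩ C⸨X⸩ where
  smul_assoc c f g := by
    have e : ∀ h : C⸨X⸩, c • h = HahnSeries.single 0 c * h := fun h => by simp
    rw [e, e, smul_eq_mul, smul_eq_mul, mul_assoc]

theorem laurent_deriv_polynomial (p : Polynomial C) :
    Differential.deriv (algebraMap (RatFunc C) C⸨X⸩ (algebraMap (Polynomial C) (RatFunc C) p)) =
      algebraMap (RatFunc C) C⸨X⸩
        (algebraMap (Polynomial C) (RatFunc C) (Polynomial.derivative p)) := by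
  induction p using Polynomial.induction_on' with
  | add p q hp hq => simp only [map_add, hp, hq]
  | monomial n a =>
    rw [laurent_monomial, Polynomial.derivative_monomial, laurent_monomial, laurent_deriv_eq]
    ext m
    rcases n with _ | n
    · simp
    · simp [mul_comm]

/-- Expanding a rational function into a Laurent series commutes with `d/dx`. -/
instance instDifferentialAlgebraLaurent : DifferentialAlgebra (RatFunc C) C⸨X⸩ where
  deriv_algebraMap f := by
    obtain ⟨p, q, hq, rfl⟩ := exists_frac f
    have hq' := RatFunc.algebraMap_ne_zero hq
    have hq'' : algebraMap (RatFunc C) C⸨X⸩ (algebraMap (Polynomial C) (RatFunc C) q) ≠ 0 := by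
      simpa using hq
    rw [ratFunc_deriv_eq, ratDeriv_div p q hq]
    have h : algebraMap (RatFunc C) C⸨X⸩ (algebraMap (Polynomial C) (RatFunc C) p) =
        algebraMap (RatFunc C) C⸨X⸩ (algebraMap (Polynomial C) (RatFunc C) p /
          algebraMap (Polynomial C) (RatFunc C) q) *
        algebraMap (RatFunc C) C⸨X⸩ (algebraMap (Polynomial C) (RatFunc C) q) := by
      rw [← map_mul, div_mul_cancel₀ _ hq']
    have h' := congrArg Differential.deriv h
    rw [differential_deriv_mul, laurent_deriv_polynomial, laurent_deriv_polynomial] at h'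
    simp only [map_div₀, map_pow, map_sub, map_mul] at h h' ⊢
    rw [eq_div_iff (pow_ne_zero 2 hq'')]
    field_simp at h'
    linear_combination (-1 : C⸨X⸩) * h'

end Laurent

/-! ### The Ore algebra `K[D]` of linear differential operators over a differential ring `K` -/

section Ore

/-- A linear differential operator `ℓ₀ + ℓ₁ D + ⋯ + ℓᵣ D^r` with coefficients in `K`, given by the
polynomial `ℓ₀ + ℓ₁ X + ⋯ + ℓᵣ X^r`. The multiplication defined below is not that of polynomials. -/
@[ext]
structure DiffOp (K : Type*) [CommRing K] where
  /-- The polynomial with the same coefficients. -/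
  poly : Polynomial K

namespace DiffOp

variable {K : Type*} [CommRing K]

/-- Operators correspond to their coefficient polynomials. -/
def equivPoly : DiffOp K ≃ Polynomial K where
  toFun := poly
  invFun := mk
  left_inv _ := rfl
  right_inv _ := rfl

/-- The addition of operators is coefficientwise. -/
noncomputable instance : AddCommGroup (DiffOp K) := equivPoly.addCommGroup

@[simp] theorem poly_add (A B : DiffOp K) : (A + B).poly = A.poly + B.poly := rfl
@[simp] theorem poly_zero : (0 : DiffOp K).poly = 0 := rfl

/-- The coefficient of `D^i`. -/
def coeff (A : DiffOp K) (i : ℕ) : K := A.poly.coeff i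

/-- The order of an operator (with the value `0` for the zero operator). -/
def ord (A : DiffOp K) : ℕ := A.poly.natDegree

noncomputable instance : One (DiffOp K) := ⟨⟨1⟩⟩

@[simp] theorem poly_one : (1 : DiffOp K).poly = 1 := rfl

variable [Differential K]

/-- Left multiplication by `D` in terms of coefficients:
`D · ∑ bⱼ D^j = ∑ (bⱼ' D^j + bⱼ D^(j+1))`, which is the commutation rule `D b = b D + b'`. -/
noncomputable def leftD : Polynomial K →+ Polynomial K where
  toFun p := (p.sum fun j b => Polynomial.monomial j (Differential.deriv b)) + Polynomial.X * p
  map_zero' := by simp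
  map_add' p q := by
    rw [Polynomial.sum_add_index p q _ (by simp) (by simp)]
    ring

theorem leftD_monomial (j : ℕ) (b : K) :
    leftD (Polynomial.monomial j b) =
      Polynomial.monomial j (Differential.deriv b) + Polynomial.monomial (j + 1) b := by
  simp [leftD, Polynomial.sum_monomial_index, Polynomial.X_mul_monomial]

theorem leftD_C_mul (a : K) (p : Polynomial K) :
    leftD (Polynomial.C a * p) =
      Polynomial.C (Differential.deriv a) * p + Polynomial.C a * leftD p := by
  induction p using Polynomial.induction_on' with
  | add p q hp hq => simp only [mul_add, map_add, hp, hq]; ring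
  | monomial j b =>
    rw [Polynomial.C_mul_monomial, leftD_monomial, leftD_monomial, differential_deriv_mul,
      mul_add, Polynomial.C_mul_monomial, Polynomial.C_mul_monomial, Polynomial.C_mul_monomial,
      map_add, mul_comm b]
    ring

/-- The product of operators in terms of coefficients:
`(∑ aᵢ D^i) · B = ∑ aᵢ (D · (D · (⋯ (D · B))))`, with `i` left multiplications by `D`. -/
noncomputable def mulPoly : Polynomial K →+ Polynomial K →+ Polynomial K where
  toFun p :=
    { toFun := fun q => p.sum fun i a => Polynomial.C a * leftD^[i] q
      map_zero' := by simp [Polynomial.sum, iterate_map_zero]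
      map_add' := fun q r => by
        simp only [Polynomial.sum, iterate_map_add, mul_add, Finset.sum_add_distrib] }
  map_zero' := by ext; simp
  map_add' p q := by
    refine AddMonoidHom.ext fun r => ?_
    exact Polynomial.sum_add_index p q (fun i a => Polynomial.C a * leftD^[i] r)
      (by simp) (by simp [add_mul])

theorem mulPoly_monomial (i : ℕ) (a : K) (q : Polynomial K) :
    mulPoly (Polynomial.monomial i a) q = Polynomial.C a * leftD^[i] q :=
  Polynomial.sum_monomial_index a (fun i a => Polynomial.C a * leftD^[i] q) (by simp)

theorem leftD_mulPoly (p q : Polynomial K) : leftD (mulPoly p q) = mulPoly (leftD p) q := by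
  induction p using Polynomial.induction_on' with
  | add p q hp hq => simp only [map_add, AddMonoidHom.add_apply, hp, hq]
  | monomial i a =>
    rw [leftD_monomial, map_add, AddMonoidHom.add_apply, mulPoly_monomial, mulPoly_monomial,
      mulPoly_monomial, leftD_C_mul, Function.iterate_succ_apply']

theorem iterate_leftD_mulPoly (i : ℕ) (p q : Polynomial K) :
    leftD^[i] (mulPoly p q) = mulPoly (leftD^[i] p) q := by
  induction i with
  | zero => rfl
  | succ i ih => rw [Function.iterate_succ_apply', Function.iterate_succ_apply', ih, leftD_mulPoly]

theorem mulPoly_C_mul (a : K) (p q : Polynomial K) :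
    mulPoly (Polynomial.C a * p) q = Polynomial.C a * mulPoly p q := by
  induction p using Polynomial.induction_on' with
  | add p q hp hq => simp only [mul_add, map_add, AddMonoidHom.add_apply, hp, hq]
  | monomial i b =>
    rw [Polynomial.C_mul_monomial, mulPoly_monomial, mulPoly_monomial, map_mul, mul_assoc]

theorem mulPoly_assoc (p q r : Polynomial K) :
    mulPoly (mulPoly p q) r = mulPoly p (mulPoly q r) := by
  induction p using Polynomial.induction_on' with
  | add p q hp hq => simp only [map_add, AddMonoidHom.add_apply, hp, hq]
  | monomial i a =>
    rw [mulPoly_monomial, mulPoly_monomial, mulPoly_C_mul, iterate_leftD_mulPoly]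

theorem iterate_leftD_one (i : ℕ) : leftD^[i] (1 : Polynomial K) = Polynomial.X ^ i := by
  induction i with
  | zero => rfl
  | succ i ih =>
    rw [Function.iterate_succ_apply', ih, ← Polynomial.monomial_one_right_eq_X_pow, leftD_monomial,
      ← Polynomial.monomial_one_right_eq_X_pow]
    simp

noncomputable instance : Mul (DiffOp K) := ⟨fun A B => ⟨mulPoly A.poly B.poly⟩⟩

@[simp] theorem poly_mul (A B : DiffOp K) : (A * B).poly = mulPoly A.poly B.poly := rfl

/-- The Ore algebra `K[D]`. -/
noncomputable instance : Ring (DiffOp K) where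
  __ := (inferInstance : AddCommGroup (DiffOp K))
  left_distrib A B E := by ext1; simp
  right_distrib A B E := by ext1; simp
  zero_mul A := by ext1; simp
  mul_zero A := by ext1; simp
  mul_assoc A B E := by ext1; simp [mulPoly_assoc]
  one_mul A := by
    ext1
    rw [poly_mul, poly_one, ← Polynomial.C_1, ← Polynomial.monomial_zero_left, mulPoly_monomial]
    simp
  mul_one A := by
    ext1
    rw [poly_mul, poly_one]
    conv_rhs => rw [A.poly.as_sum_range_C_mul_X_pow]
    change (A.poly.sum fun i a => Polynomial.C a * leftD^[i] 1) = _
    rw [Polynomial.sum_over_range _ (by simp)]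
    simp only [iterate_leftD_one]

/-- The action of operators on a differential extension `F` of `K`:
`(∑ ℓᵢ D^i) · f = ∑ ℓᵢ f^(i)`. -/
noncomputable def act {F : Type*} [CommRing F] [Differential F] [Algebra K F]
    (A : DiffOp K) (f : F) : F :=
  A.poly.sum fun i a => algebraMap K F a * (fun g => Differential.deriv g)^[i] f

/-- The action turns products of operators into compositions. -/
theorem act_mul {F : Type*} [CommRing F] [Differential F] [Algebra K F] [DifferentialAlgebra K F]
    (A B : DiffOp K) (f : F) : (A * B).act f = A.act (B.act f) := by
  have hadd : ∀ (p q : Polynomial K) (f : F),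
      (DiffOp.mk (p + q)).act f = (DiffOp.mk p).act f + (DiffOp.mk q).act f := fun p q f =>
    Polynomial.sum_add_index p q _ (by simp) (by simp [add_mul])
  have hmon : ∀ (i : ℕ) (a : K) (f : F), (DiffOp.mk (Polynomial.monomial i a)).act f =
      algebraMap K F a * (fun g => Differential.deriv g)^[i] f := fun i a f =>
    Polynomial.sum_monomial_index _ _ (by simp)
  have hC : ∀ (a : K) (p : Polynomial K) (f : F),
      (DiffOp.mk (Polynomial.C a * p)).act f = algebraMap K F a * (DiffOp.mk p).act f := by
    intro a p f
    induction p using Polynomial.induction_on' with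
    | add p q hp hq => simp only [mul_add, hadd, hp, hq]
    | monomial i b => simp only [Polynomial.C_mul_monomial, hmon, map_mul, mul_assoc]
  have hD : ∀ (p : Polynomial K) (f : F),
      (DiffOp.mk (leftD p)).act f = Differential.deriv ((DiffOp.mk p).act f) := by
    intro p f
    induction p using Polynomial.induction_on' with
    | add p q hp hq => simp only [map_add, hadd, hp, hq]
    | monomial i b =>
      rw [leftD_monomial, hadd, hmon, hmon, hmon, differential_deriv_mul, deriv_algebraMap,
        Function.iterate_succ_apply']
      ring
  have hDi : ∀ (i : ℕ) (p : Polynomial K) (f : F), (DiffOp.mk (leftD^[i] p)).act f =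
      (fun g => Differential.deriv g)^[i] ((DiffOp.mk p).act f) := by
    intro i p f
    induction i with
    | zero => rfl
    | succ i ih => rw [Function.iterate_succ_apply', Function.iterate_succ_apply', hD, ih]
  obtain ⟨p⟩ := A
  obtain ⟨q⟩ := B
  change (DiffOp.mk (mulPoly p q)).act f = _
  induction p using Polynomial.induction_on' with
  | add p r hp hr => simp only [map_add, AddMonoidHom.add_apply, hadd, hp, hr]
  | monomial i a => rw [mulPoly_monomial, hC, hDi, hmon]

/-- `A` is a right factor of `B`: there is an operator `R` with `B = R A`. -/
def IsRightFactor (A B : DiffOp K) : Prop := ∃ R : DiffOp K, B = R * A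

end DiffOp

end Ore

/-! ### Operators over `C(x)`: solutions, symmetric products, singularities, colon spaces -/

namespace DiffOp

universe u

variable {C : Type u} [Field C]

/-- The solution space `V_F(L)` as a `C`-subspace of a differential extension `F` of `C(x)`. -/
noncomputable def solutionSpace (F : Type*) [CommRing F] [Differential F] [Algebra (RatFunc C) F]
    [DifferentialAlgebra (RatFunc C) F] [Module C F] [IsScalarTower C (RatFunc C) F]
    (L : DiffOp (RatFunc C)) : Submodule C F where
  carrier := {f | L.act f = 0}
  zero_mem' := by
    have h : ∀ i : ℕ, (fun g : F => Differential.deriv g)^[i] 0 = 0 := fun i =>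
      Function.iterate_fixed (map_zero _) i
    simp [act, Polynomial.sum, h]
  add_mem' {f g} hf hg := by
    have h : ∀ i : ℕ, (fun g : F => Differential.deriv g)^[i] (f + g) =
        (fun g : F => Differential.deriv g)^[i] f + (fun g : F => Differential.deriv g)^[i] g := by
      intro i
      induction i with
      | zero => rfl
      | succ i ih => simp only [Function.iterate_succ_apply', ih, map_add]
    have e : L.act (f + g) = L.act f + L.act g := by
      simp only [act, Polynomial.sum, h, mul_add, Finset.sum_add_distrib]
    rw [Set.mem_ofPred_eq] at hf hg ⊢
    rw [e, hf, hg, add_zero]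
  smul_mem' c f hf := by
    have hc : ∀ g : F, c • g = algebraMap (RatFunc C) F (algebraMap C (RatFunc C) c) * g := by
      intro g
      rw [← Algebra.smul_def, algebraMap_smul]
    have hd : ∀ g : F, Differential.deriv (c • g) = c • Differential.deriv g := by
      intro g
      rw [hc, hc, differential_deriv_mul, deriv_algebraMap, ratFunc_deriv_eq,
        IsScalarTower.algebraMap_apply C (Polynomial C) (RatFunc C), ratDeriv_algebraMap]
      simp
    have h : ∀ i : ℕ, (fun g : F => Differential.deriv g)^[i] (c • f) =
        c • (fun g : F => Differential.deriv g)^[i] f := by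
      intro i
      induction i with
      | zero => rfl
      | succ i ih => simp only [Function.iterate_succ_apply', ih, hd]
    have e : L.act (c • f) = c • L.act f := by
      simp only [act, Polynomial.sum, h]
      simp only [hc, Finset.mul_sum]
      exact Finset.sum_congr rfl fun i _ => by ring
    rw [Set.mem_ofPred_eq] at hf ⊢
    rw [e, hf, smul_zero]

/-- `P` annihilates `f g` for all solutions `f` of `L` and `g` of `Q`, in every differential ring
extension of `C(x)`. -/
def AnnihilatesProducts (L Q P : DiffOp (RatFunc C)) : Prop :=
  ∀ (F : Type u) [CommRing F] [Differential F] [Algebra (RatFunc C) F]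
    [DifferentialAlgebra (RatFunc C) F] (f g : F),
    L.act f = 0 → Q.act g = 0 → P.act (f * g) = 0

/-- An operator is primitive if its coefficients are polynomials whose only common factors are
constants. -/
def IsPrimitive (P : DiffOp (RatFunc C)) : Prop :=
  ∃ p : ℕ → Polynomial C,
    (∀ i, P.coeff i = algebraMap (Polynomial C) (RatFunc C) (p i)) ∧
    ∀ d : Polynomial C, (∀ i, d ∣ p i) → IsUnit d

/-- `S` is the symmetric product `L ⊗ Q`: a primitive nonzero operator of lowest order which
annihilates all products of a solution of `L` and a solution of `Q`. It is unique up to a nonzero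
constant factor. -/
structure IsSymmetricProduct (L Q S : DiffOp (RatFunc C)) : Prop where
  ne_zero : S ≠ 0
  primitive : S.IsPrimitive
  annihilates : AnnihilatesProducts L Q S
  minimal : ∀ P : DiffOp (RatFunc C), P ≠ 0 → AnnihilatesProducts L Q P → S.ord ≤ P.ord

/-- `ξ` is a singularity of `L = ℓ₀ + ⋯ + ℓᵣ D^r`, `ℓᵣ ≠ 0`: it is a pole of one of the rational
functions `ℓᵢ / ℓᵣ` with `i < r`. -/
def IsSingularity (L : DiffOp (RatFunc C)) (ξ : C) : Prop :=
  ∃ i < L.ord, (L.coeff i / L.coeff L.ord).denom.eval ξ = 0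

/-- An ordinary point is one which is not a singularity. -/
def IsOrdinaryPoint (L : DiffOp (RatFunc C)) (ξ : C) : Prop := ¬ L.IsSingularity ξ

/-- The space `C[[x]]` inside `C((x))`. -/
noncomputable def powerSeriesSubspace (C : Type u) [Field C] : Submodule C C⸨X⸩ where
  carrier := Set.range (HahnSeries.ofPowerSeries ℤ C)
  zero_mem' := ⟨0, map_zero _⟩
  add_mem' := by
    rintro _ _ ⟨f, rfl⟩ ⟨g, rfl⟩
    exact ⟨f + g, map_add _ _ _⟩
  smul_mem' := by
    rintro c _ ⟨f, rfl⟩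
    exact ⟨PowerSeries.C c * f, by simp⟩

/-- `0` is an apparent singularity of `L`: it is a singularity, and the solutions of `L` in
`C[[x]]` form a space of dimension `ord L`. -/
def IsApparentSingularityAtZero (L : DiffOp (RatFunc C)) : Prop :=
  L.IsSingularity 0 ∧
    Module.rank C ↥(L.solutionSpace C⸨X⸩ ⊓ powerSeriesSubspace C) = (L.ord : Cardinal)

/-- The colon space `(V : U) = {h ∈ K | h U ⊆ V}`. -/
def colonSpace {K : Type*} [CommRing K] [Module C K] [IsScalarTower C K K]
    (V : Submodule C K) (U : Set K) : Submodule C K where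
  carrier := {h | ∀ u ∈ U, h * u ∈ V}
  zero_mem' u _ := by rw [zero_mul]; exact V.zero_mem
  add_mem' {f g} hf hg u hu := by rw [add_mul]; exact V.add_mem (hf u hu) (hg u hu)
  smul_mem' c f hf u hu := by rw [smul_mul_assoc]; exact V.smul_mem c (hf u hu)

end DiffOp

/-! Write K for C((x)). Since 0 is an ordinary point of L and ord L > 0, L has a power series
solution f with f(0) ≠ 0. Every left multiple of L ⊗ Q, in particular M, annihilates fg for each
solution g of Q in each differential ring extension of C(x). Claim 2 and the inequality in claim 3
follow by taking the extension K itself.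

For ord Q = dim V(Q), take a generic solution of Q: the class of 1 in K[D]/K[D]Q. The square-zero
extension K ⊕ K[D]/K[D]Q is a differential ring containing both f and this class, and M annihilates
their product exactly when M f = R Q in K[D] for some R (`exists_extend_mul_const_eq`). Hence ord M
= ord R + ord Q. The map g ↦ Q(g/f) sends V(M) to ker R with kernel inside f V(Q), so ord M ≤ dim
V(M) ≤ dim ker R + dim V(Q) ≤ ord R + dim V(Q), which gives ord Q ≤ dim V(Q). The first inequality
is the existence of power series solutions at an ordinary point (`ord_le_rank_of_isOrdinaryPoint`);
the last one, and dim V(Q) ≤ ord Q, are the general bound dim ker A ≤ ord A over K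
(`rank_ker_actLinearMap_le`).

For claim 1, equality of dimensions forces V(M) ⊆ C[[x]]. If g ∈ V(Q), then fg ∈ V(M) is a power
series, and so is g because f is a unit of C[[x]]. Thus V(Q) is a space of power series of dimension
ord Q. -/

namespace DiffOp

/-! ### The algebra of differential operators -/

section Algebra

variable {K : Type*} [CommRing K] [Differential K]

/-- The operator of order at most `0` which multiplies by `a`. -/
noncomputable def const : K →+* DiffOp K where
  toFun a := ⟨Polynomial.C a⟩
  map_one' := by ext1; simp
  map_mul' a b := by
    ext1
    have h := mulPoly_monomial 0 a (Polynomial.C b)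
    rw [Polynomial.monomial_zero_left] at h
    exact (map_mul _ _ _).trans h.symm
  map_zero' := by ext1; simp
  map_add' a b := by ext1; simp

/-- The operator `D`. -/
noncomputable def D : DiffOp K := ⟨Polynomial.X⟩

theorem poly_const (a : K) : (const a).poly = Polynomial.C a := rfl

theorem poly_const_mul (a : K) (A : DiffOp K) :
    (const a * A).poly = Polynomial.C a * A.poly := by
  rw [poly_mul, poly_const, ← Polynomial.monomial_zero_left, mulPoly_monomial]
  simp

theorem poly_D_mul (A : DiffOp K) : (D * A).poly = leftD A.poly := by
  rw [poly_mul, D, ← Polynomial.monomial_one_one_eq_X, mulPoly_monomial]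
  simp

theorem poly_D_pow_mul (n : ℕ) (A : DiffOp K) : (D ^ n * A).poly = leftD^[n] A.poly := by
  induction n with
  | zero => simp
  | succ n ih => rw [pow_succ', mul_assoc, poly_D_mul, ih, Function.iterate_succ_apply']

theorem mk_monomial (n : ℕ) (a : K) :
    (⟨Polynomial.monomial n a⟩ : DiffOp K) = const a * D ^ n := by
  ext1
  have h := poly_D_pow_mul n (1 : DiffOp K)
  rw [mul_one, poly_one, iterate_leftD_one] at h
  rw [poly_const_mul, h, Polynomial.C_mul_X_pow_eq_monomial]

theorem D_mul_const (a : K) : D * const a = const a * D + const (Differential.deriv a) := by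
  ext1
  have h := leftD_monomial 0 a
  rw [Polynomial.monomial_zero_left, Polynomial.monomial_zero_left, zero_add,
    ← Polynomial.C_mul_X_eq_monomial, add_comm] at h
  rw [poly_add, poly_const_mul, poly_D_mul, poly_const, poly_const, h]
  rfl

/-- With coefficients on the left, multiplication by D on the right needs no commutation and only
shifts. So an operator with zero constant coefficient is divisible by D on the right. -/
theorem mk_mul_D (p : Polynomial K) :
    (⟨p⟩ : DiffOp K) * D = ⟨p * Polynomial.X⟩ := by
  induction p using Polynomial.induction_on' with
  | add p q hp hq =>
    have h : (⟨p + q⟩ : DiffOp K) = ⟨p⟩ + ⟨q⟩ := rfl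
    rw [h, add_mul, hp, hq, add_mul]
    rfl
  | monomial n a =>
    rw [mk_monomial, mul_assoc, ← pow_succ, ← mk_monomial, Polynomial.monomial_mul_X]

theorem induction_on {P : DiffOp K → Prop} (A : DiffOp K)
    (add : ∀ A B, P A → P B → P (A + B)) (monomial : ∀ n a, P (const a * D ^ n)) : P A := by
  obtain ⟨p⟩ := A
  induction p using Polynomial.induction_on' with
  | add p q hp hq => exact add _ _ hp hq
  | monomial n a => rw [mk_monomial]; exact monomial n a

theorem coeff_leftD_succ (p : Polynomial K) (n : ℕ) :
    (leftD p).coeff (n + 1) = Differential.deriv (p.coeff (n + 1)) + p.coeff n := by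
  induction p using Polynomial.induction_on' with
  | add p q hp hq => simp only [map_add, Polynomial.coeff_add, hp, hq]; ring
  | monomial m a =>
    simp only [leftD_monomial, Polynomial.coeff_add, Polynomial.coeff_monomial,
      add_left_inj]
    split_ifs <;> simp

/-- In D b = b D + b', the correction b' has lower order, so each factor D raises the degree bound
by one and keeps the top coefficient. Leading coefficients therefore multiply and, over a domain,
orders add. -/
theorem coeff_iterate_leftD (p : Polynomial K) (m : ℕ) (hp : p.natDegree ≤ m) (i : ℕ) :
    (∀ n, i + m < n → (leftD^[i] p).coeff n = 0) ∧ (leftD^[i] p).coeff (i + m) = p.coeff m := by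
  induction i with
  | zero =>
    refine ⟨fun n hn => ?_, by simp⟩
    exact Polynomial.coeff_eq_zero_of_natDegree_lt (p := p) (by omega)
  | succ i ih =>
    rw [Function.iterate_succ_apply']
    constructor
    · intro n hn
      obtain ⟨n, rfl⟩ : ∃ k, n = k + 1 := ⟨n - 1, by omega⟩
      rw [coeff_leftD_succ, ih.1 n (by omega), ih.1 (n + 1) (by omega), map_zero, zero_add]
    · rw [show i + 1 + m = i + m + 1 by omega, coeff_leftD_succ, ih.1 _ (by omega), ih.2,
        map_zero, zero_add]

theorem coeff_mul_eq_sum (A B : DiffOp K) (n : ℕ) : (A * B).coeff n =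
    ∑ i ∈ Finset.range (A.ord + 1), A.coeff i * (leftD^[i] B.poly).coeff n := by
  have h : (A * B).poly = A.poly.sum fun i a => Polynomial.C a * leftD^[i] B.poly := rfl
  rw [coeff, h, Polynomial.sum_over_range _ (by simp), Polynomial.finsetSum_coeff]
  simp [ord, coeff]

theorem coeff_mul_ord_add_ord (A B : DiffOp K) :
    (A * B).coeff (A.ord + B.ord) = A.coeff A.ord * B.coeff B.ord := by
  have hd := coeff_iterate_leftD B.poly B.ord le_rfl
  rw [coeff_mul_eq_sum, Finset.sum_range_succ, Finset.sum_eq_zero, (hd A.ord).2, zero_add]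
  · rfl
  · intro i hi
    rw [Finset.mem_range] at hi
    rw [(hd i).1 _ (by omega), mul_zero]

theorem coeff_ord_ne_zero {A : DiffOp K} (hA : A ≠ 0) : A.coeff A.ord ≠ 0 :=
  Polynomial.leadingCoeff_ne_zero.2 fun h => hA (DiffOp.ext h)

instance [IsDomain K] : NoZeroDivisors (DiffOp K) where
  eq_zero_or_eq_zero_of_mul_eq_zero {A B} h := by
    by_contra! hAB
    have hc := coeff_mul_ord_add_ord A B
    rw [h] at hc
    exact mul_ne_zero (coeff_ord_ne_zero hAB.1) (coeff_ord_ne_zero hAB.2) hc.symm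

theorem ord_mul [IsDomain K] {A B : DiffOp K} (hA : A ≠ 0) (hB : B ≠ 0) :
    (A * B).ord = A.ord + B.ord := by
  apply Polynomial.natDegree_eq_of_le_of_coeff_ne_zero
  · rw [Polynomial.natDegree_le_iff_coeff_eq_zero]
    intro n hn
    refine (coeff_mul_eq_sum A B n).trans (Finset.sum_eq_zero fun i hi => ?_)
    rw [Finset.mem_range] at hi
    rw [(coeff_iterate_leftD B.poly B.ord le_rfl i).1 n (by omega), mul_zero]
  · exact (coeff_mul_ord_add_ord A B).trans_ne
      (mul_ne_zero (coeff_ord_ne_zero hA) (coeff_ord_ne_zero hB))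

theorem ord_const (a : K) : (const a).ord = 0 := Polynomial.natDegree_C a

theorem const_ne_zero {a : K} (ha : a ≠ 0) : const a ≠ 0 := fun h =>
  ha (Polynomial.C_injective ((congrArg poly h).trans Polynomial.C_0.symm))

end Algebra

/-! ### Extension of coefficients and the action -/

section Action

variable {k : Type*} [CommRing k] {K : Type*} [CommRing K] [Algebra k K]

/-- The operator over `K` with the same coefficients as an operator over `k`. -/
noncomputable def extend (K : Type*) [CommRing K] [Algebra k K] (A : DiffOp k) : DiffOp K :=
  ⟨A.poly.map (algebraMap k K)⟩

theorem ord_extend [IsDomain K] [FaithfulSMul k K] (A : DiffOp k) : (A.extend K).ord = A.ord :=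
  Polynomial.natDegree_map_eq_of_injective (FaithfulSMul.algebraMap_injective k K) _

theorem extend_ne_zero [FaithfulSMul k K] {A : DiffOp k} (hA : A ≠ 0) : A.extend K ≠ 0 := by
  intro h
  apply hA
  ext1
  exact (Polynomial.map_eq_zero_iff (FaithfulSMul.algebraMap_injective k K)).1 (congrArg poly h)

variable [Differential k]

theorem extend_add (A B : DiffOp k) : (A + B).extend K = A.extend K + B.extend K := by
  ext1; simp [extend]

theorem extend_const_mul_D_pow [Differential K] (n : ℕ) (a : k) :
    (const a * D ^ n).extend K = const (algebraMap k K a) * D ^ n := by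
  rw [← mk_monomial, ← mk_monomial]
  simp [extend]

variable {F : Type*} [CommRing F] [Differential F] [Algebra k F]

theorem act_add (A B : DiffOp k) (f : F) : (A + B).act f = A.act f + B.act f :=
  Polynomial.sum_add_index A.poly B.poly _ (by simp) (by simp [add_mul])

theorem act_const_mul_D_pow (n : ℕ) (a : k) (f : F) :
    (const a * D ^ n).act f = algebraMap k F a * (fun g => Differential.deriv g)^[n] f := by
  rw [← mk_monomial]
  exact Polynomial.sum_monomial_index _ _ (by simp)

theorem act_const (a : k) (f : F) : (const a).act f = algebraMap k F a * f := by
  simpa using act_const_mul_D_pow 0 a f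

theorem act_D (f : F) : (D : DiffOp k).act f = Differential.deriv f := by
  simpa using act_const_mul_D_pow 1 (1 : k) f

/-- All derivatives of 1 vanish. Hence an operator over F that annihilates 1 has no constant
coefficient; this is the source of the factor D in the reduction of order. -/
theorem act_one_right [DifferentialAlgebra k F] (A : DiffOp k) :
    A.act (1 : F) = algebraMap k F (A.coeff 0) := by
  induction A using induction_on with
  | add A B hA hB =>
    rw [act_add, hA, hB, ← map_add]
    simp [coeff]
  | monomial n a =>
    rw [act_const_mul_D_pow, ← mk_monomial]
    rcases n with _ | n
    · simp [coeff]
    · have h : (fun g : F => Differential.deriv g)^[n] 0 = 0 :=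
        Function.iterate_fixed (map_zero _) n
      rw [Function.iterate_succ_apply, Derivation.map_one_eq_zero, h]
      simp [coeff, Polynomial.coeff_monomial]

theorem act_extend [Differential K] (A : DiffOp k) (f : K) : (A.extend K).act f = A.act f := by
  induction A using induction_on with
  | add A B hA hB => rw [extend_add, act_add, act_add, hA, hB]
  | monomial n a => rw [extend_const_mul_D_pow, act_const_mul_D_pow, act_const_mul_D_pow]; rfl

end Action

/-! ### The generic solution of an operator -/

section GenericSolution

universe u

variable {K : Type u} [CommRing K] [Differential K]

/-- The left module `K[D] / K[D] Q`. -/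
def CyclicModule (Q : DiffOp K) : Type u := DiffOp K ⧸ Submodule.span (DiffOp K) {Q}

namespace CyclicModule

variable (Q : DiffOp K)

noncomputable instance : AddCommGroup (CyclicModule Q) :=
  inferInstanceAs (AddCommGroup (DiffOp K ⧸ Submodule.span (DiffOp K) {Q}))

noncomputable instance : Module (DiffOp K) (CyclicModule Q) :=
  inferInstanceAs (Module (DiffOp K) (DiffOp K ⧸ Submodule.span (DiffOp K) {Q}))

noncomputable instance : Module K (CyclicModule Q) := Module.compHom _ (const (K := K))

/-- The ring structure of `TrivSqZeroExt` asks for a right action as well; it is taken equal to the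
left one, which makes the extension commutative. -/
noncomputable instance : Module Kᵐᵒᵖ (CyclicModule Q) :=
  Module.compHom _ ((RingEquiv.toOpposite K).symm : Kᵐᵒᵖ →+* K)

instance : IsCentralScalar K (CyclicModule Q) where
  op_smul_eq_smul _ _ := rfl

/-- The class of `1`, a generic solution of `Q`. -/
noncomputable def gen : CyclicModule Q := Submodule.Quotient.mk (1 : DiffOp K)

variable {Q}

theorem smul_def (a : K) (n : CyclicModule Q) : a • n = const a • n := rfl

/-- This is what makes the class of 1 generic: it satisfies only the equations forced by Q, so
annihilating it amounts to right divisibility by Q. -/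
theorem smul_gen_eq_zero_iff (A : DiffOp K) : A • gen Q = 0 ↔ ∃ R : DiffOp K, A = R * Q := by
  have h : A • gen Q = Submodule.Quotient.mk A := by
    refine (Submodule.Quotient.mk_smul _ A (1 : DiffOp K)).symm.trans ?_
    rw [smul_eq_mul, mul_one]
  rw [h]
  refine (Submodule.Quotient.mk_eq_zero _).trans ?_
  rw [Submodule.mem_span_singleton]
  simp only [smul_eq_mul, eq_comm]

/-- The derivation of `K ⊕ K[D]/K[D]Q`, the second summand having square zero. -/
noncomputable instance : Differential (TrivSqZeroExt K (CyclicModule Q)) :=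
  differentialOfLeibniz
    (AddMonoidHom.mk'
      (fun x => TrivSqZeroExt.inl (Differential.deriv x.fst) + TrivSqZeroExt.inr (D (K := K) • x.snd))
      (fun a b => by ext <;> simp))
    (fun a b => by
      ext
      · simp
      -- The Leibniz rule on mixed products is the commutation rule D c = c D + c'; products of two
      -- elements of the second summand vanish.
      · have h : ∀ (c : K) (n : CyclicModule Q),
            D (K := K) • c • n = c • D (K := K) • n + Differential.deriv c • n := by
          intro c n
          rw [smul_def, smul_def, smul_def, ← mul_smul, ← mul_smul, ← add_smul, D_mul_const]
        simp [h]
        abel)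

theorem deriv_eq (x : TrivSqZeroExt K (CyclicModule Q)) : Differential.deriv x =
    TrivSqZeroExt.inl (Differential.deriv x.fst) + TrivSqZeroExt.inr (D (K := K) • x.snd) := rfl

theorem deriv_inr (n : CyclicModule Q) :
    Differential.deriv (TrivSqZeroExt.inr n : TrivSqZeroExt K (CyclicModule Q)) =
      TrivSqZeroExt.inr (D (K := K) • n) := by
  simp [deriv_eq]

theorem deriv_inl (a : K) :
    Differential.deriv (TrivSqZeroExt.inl a : TrivSqZeroExt K (CyclicModule Q)) =
      TrivSqZeroExt.inl (Differential.deriv a) := by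
  simp [deriv_eq]

variable {k : Type*} [CommRing k] [Algebra k K]

noncomputable instance : Algebra k (TrivSqZeroExt K (CyclicModule Q)) :=
  ((TrivSqZeroExt.inlHom K (CyclicModule Q)).comp (algebraMap k K)).toAlgebra

theorem algebraMap_eq (a : k) : algebraMap k (TrivSqZeroExt K (CyclicModule Q)) a =
    TrivSqZeroExt.inl (algebraMap k K a) := rfl

variable [Differential k]

instance [DifferentialAlgebra k K] :
    DifferentialAlgebra k (TrivSqZeroExt K (CyclicModule Q)) where
  deriv_algebraMap a := by rw [algebraMap_eq, algebraMap_eq, deriv_inl, deriv_algebraMap]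

theorem act_inl (A : DiffOp k) (f : K) :
    A.act (TrivSqZeroExt.inl f : TrivSqZeroExt K (CyclicModule Q)) =
      TrivSqZeroExt.inl (A.act f) := by
  induction A using induction_on with
  | add A B hA hB => rw [act_add, act_add, hA, hB, TrivSqZeroExt.inl_add]
  | monomial n a =>
    have h : ∀ n, (fun g : TrivSqZeroExt K (CyclicModule Q) => Differential.deriv g)^[n]
        (TrivSqZeroExt.inl f) =
          TrivSqZeroExt.inl ((fun g : K => Differential.deriv g)^[n] f) := by
      intro n
      induction n with
      | zero => rfl
      | succ n ih => rw [Function.iterate_succ_apply', Function.iterate_succ_apply', ih, deriv_inl]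
    rw [act_const_mul_D_pow, act_const_mul_D_pow, h, algebraMap_eq, TrivSqZeroExt.inl_mul_inl]

theorem act_inr (A : DiffOp k) (n : CyclicModule Q) :
    A.act (TrivSqZeroExt.inr n : TrivSqZeroExt K (CyclicModule Q)) =
      TrivSqZeroExt.inr (A.extend K • n) := by
  induction A using induction_on with
  | add A B hA hB => rw [act_add, extend_add, hA, hB, add_smul, TrivSqZeroExt.inr_add]
  | monomial i a =>
    have h : ∀ i, (fun g : TrivSqZeroExt K (CyclicModule Q) => Differential.deriv g)^[i]
        (TrivSqZeroExt.inr n) = TrivSqZeroExt.inr (D (K := K) ^ i • n) := by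
      intro i
      induction i with
      | zero => simp
      | succ i ih => rw [Function.iterate_succ_apply', ih, deriv_inr, pow_succ', mul_smul]
    rw [act_const_mul_D_pow, extend_const_mul_D_pow, h, algebraMap_eq, TrivSqZeroExt.inl_mul_inr,
      mul_smul]
    rfl

end CyclicModule

end GenericSolution

end DiffOp

namespace DiffOp

/-! ### The dimension of the solution space in `C((x))` is at most the order -/

section RankBound

variable {C : Type*} [Field C]

theorem act_add_right {k : Type*} [CommRing k] [Differential k] {F : Type*} [CommRing F]
    [Differential F] [Algebra k F] (A : DiffOp k) (f g : F) :
    A.act (f + g) = A.act f + A.act g := by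
  induction A using induction_on with
  | add A B hA hB => rw [act_add, act_add, act_add, hA, hB]; ring
  | monomial n a =>
    simp only [act_const_mul_D_pow, ← mul_add]
    congr 1
    exact iterate_map_add (Differential.deriv : Derivation ℤ F F) n f g

theorem act_smul_right (A : DiffOp C⸨X⸩) (c : C) (f : C⸨X⸩) : A.act (c • f) = c • A.act f := by
  induction A using induction_on with
  | add A B hA hB => rw [act_add, act_add, hA, hB, smul_add]
  | monomial n a =>
    have h : (fun g : C⸨X⸩ => Differential.deriv g)^[n] (c • f) =
        c • (fun g : C⸨X⸩ => Differential.deriv g)^[n] f := by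
      induction n with
      | zero => rfl
      | succ n ih =>
        rw [Function.iterate_succ_apply', Function.iterate_succ_apply', ih, laurent_deriv_eq,
          laurent_deriv_eq, map_smul]
    rw [act_const_mul_D_pow, act_const_mul_D_pow, h, mul_smul_comm]

/-- The action of an operator over `C((x))` as a `C`-linear map. -/
noncomputable def actLinearMap (A : DiffOp C⸨X⸩) : C⸨X⸩ →ₗ[C] C⸨X⸩ where
  toFun := A.act
  map_add' := A.act_add_right
  map_smul' := A.act_smul_right

theorem mem_ker_actLinearMap {A : DiffOp C⸨X⸩} {f : C⸨X⸩} :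
    f ∈ A.actLinearMap.ker ↔ A.act f = 0 := Iff.rfl

/-- Rank-nullity for φ restricted to U: its range lies in X and its kernel embeds in Y. Working with
cardinals avoids finiteness assumptions. -/
theorem rank_le_add_of_linearMap {V : Type*} [AddCommGroup V] [Module C V]
    (φ : V →ₗ[C] V) (U X Y : Submodule C V) (hX : ∀ u ∈ U, φ u ∈ X)
    (hY : ∀ u ∈ U, φ u = 0 → u ∈ Y) : Module.rank C U ≤ Module.rank C X + Module.rank C Y := by
  rw [← LinearMap.rank_range_add_rank_ker (φ.restrict hX : U →ₗ[C] X)]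
  refine add_le_add (Submodule.rank_le _) ?_
  refine LinearMap.rank_le_of_injective
    ((U.subtype.domRestrict (φ.restrict hX).ker).codRestrict Y fun u => ?_) ?_
  · exact hY _ u.1.2 (congrArg Subtype.val u.2)
  · intro u v huv
    have huv' : (u : U).1 = (v : U).1 := congrArg (Subtype.val : Y → V) huv
    exact Subtype.ext (Subtype.ext huv')

/-- If A g = 0 and h = g/f, then R(Q h) = A(f h) = 0. So g ↦ Q(g/f) maps ker A into ker R, and
whatever it kills lies in f ker Q. -/
theorem rank_ker_le_of_mul_const_eq {A R Q : DiffOp C⸨X⸩} {f : C⸨X⸩} (hf : f ≠ 0)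
    (h : A * const f = R * Q) : Module.rank C A.actLinearMap.ker ≤
      Module.rank C R.actLinearMap.ker + Module.rank C Q.actLinearMap.ker := by
  have hdiv : ∀ g : C⸨X⸩, f * (f⁻¹ * g) = g := fun g => mul_inv_cancel_left₀ hf g
  refine (rank_le_add_of_linearMap
    (Q.actLinearMap ∘ₗ LinearMap.mulLeft C f⁻¹) _ R.actLinearMap.ker
    (Q.actLinearMap.ker.map (LinearMap.mulLeft C f)) ?_ ?_).trans
    (add_le_add le_rfl (rank_map_le _ _))
  · intro g hg
    rw [mem_ker_actLinearMap] at hg ⊢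
    change R.act (Q.act (f⁻¹ * g)) = 0
    rw [← act_mul, ← h, act_mul, act_const, Algebra.algebraMap_self_apply, hdiv, hg]
  · intro g _ hg
    exact ⟨f⁻¹ * g, hg, hdiv g⟩

variable [CharZero C]

/-- The coefficient of x^(n-1) in f' is n times that of x^n in f. In characteristic zero f' = 0 thus
leaves only the constant term. -/
theorem rank_ker_D_le : Module.rank C (D : DiffOp C⸨X⸩).actLinearMap.ker ≤ 1 := by
  rw [rank_submodule_le_one_iff']
  refine ⟨1, fun f hf => ?_⟩
  rw [mem_ker_actLinearMap, act_D, laurent_deriv_eq] at hf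
  rw [Submodule.mem_span_singleton]
  refine ⟨f.coeff 0, ?_⟩
  ext n
  rw [HahnSeries.coeff_smul, HahnSeries.coeff_one]
  split_ifs with hn
  · simp [hn]
  · have h := congrArg (fun g : C⸨X⸩ => g.coeff (n - 1)) hf
    have hn' : (n : C) ≠ 0 := by exact_mod_cast hn
    simpa [hn', eq_comm] using h

/-- Reduction of order: for a nonzero solution f, the operator A f annihilates 1, so A f = R D with
ord R = ord A - 1, and D contributes at most one dimension. -/
theorem rank_ker_actLinearMap_le {A : DiffOp C⸨X⸩} (hA : A ≠ 0) :
    Module.rank C A.actLinearMap.ker ≤ A.ord := by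
  induction hn : A.ord generalizing A with
  | zero =>
    obtain ⟨a, ha⟩ := Polynomial.natDegree_eq_zero.1 hn
    have ha' : A = const a := DiffOp.ext ha.symm
    have ha0 : a ≠ 0 := by rintro rfl; exact hA (ha'.trans (map_zero _))
    have h : A.actLinearMap.ker = ⊥ := by
      rw [Submodule.eq_bot_iff]
      intro f hf
      rw [mem_ker_actLinearMap, ha', act_const] at hf
      exact (mul_eq_zero.1 hf).resolve_left ha0
    rw [h]
    simp
  | succ n ih =>
    by_cases hbot : A.actLinearMap.ker = ⊥
    · rw [hbot]
      simp
    obtain ⟨f, hf, hf0⟩ := Submodule.exists_mem_ne_zero_of_ne_bot hbot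
    rw [mem_ker_actLinearMap] at hf
    have hne : A * const f ≠ 0 := mul_ne_zero hA (const_ne_zero hf0)
    have h0 : (A * const f).coeff 0 = 0 := by
      have h := act_one_right (F := C⸨X⸩) (A * const f)
      rw [act_mul, act_const, mul_one, Algebra.algebraMap_self_apply, hf] at h
      exact h.symm
    obtain ⟨p, hp⟩ := Polynomial.X_dvd_iff.2 h0
    have hfac : A * const f = ⟨p⟩ * D := by
      rw [mk_mul_D, mul_comm]
      exact DiffOp.ext hp
    have hR : (⟨p⟩ : DiffOp C⸨X⸩) ≠ 0 := left_ne_zero_of_mul (hfac ▸ hne)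
    have hD : (D : DiffOp C⸨X⸩) ≠ 0 := right_ne_zero_of_mul (hfac ▸ hne)
    have hord := congrArg ord hfac
    rw [ord_mul hA (const_ne_zero hf0), ord_mul hR hD, ord_const, hn] at hord
    have hD1 : (D : DiffOp C⸨X⸩).ord = 1 := Polynomial.natDegree_X
    refine (rank_ker_le_of_mul_const_eq hf0 hfac).trans ?_
    rw [Nat.cast_add, Nat.cast_one]
    exact add_le_add (ih hR (by omega)) rank_ker_D_le

end RankBound

/-! ### Power series solutions at an ordinary point -/

section Existence

/-- Strong recursion: the rule for the m-th term reads only earlier terms, so the terms from m on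
may be replaced by 0 while it is evaluated. -/
theorem exists_seq_of_forall_lt {α : Type*} [Zero α] (G : ℕ → (ℕ → α) → α)
    (hG : ∀ m y z, (∀ j < m, y j = z j) → G m y = G m z) : ∃ y : ℕ → α, ∀ m, y m = G m y := by
  let y : ℕ → α := fun m => Nat.strongRecOn m fun m ih =>
    G m fun j => if h : j < m then ih j h else 0
  refine ⟨y, fun m => ?_⟩
  have h : y m = G m fun j => if j < m then y j else 0 := by
    simp only [y]
    rw [Nat.strongRecOn_eq]
    rfl
  rw [h]
  exact hG m _ _ fun j hj => if_pos hj

variable {C : Type*} [Field C]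

theorem iterate_deriv_ofPowerSeries (y : PowerSeries C) (n : ℕ) :
    (fun g : C⸨X⸩ => Differential.deriv g)^[n] (HahnSeries.ofPowerSeries ℤ C y) =
      HahnSeries.ofPowerSeries ℤ C ((PowerSeries.derivative C)^[n] y) := by
  have h : ∀ y : PowerSeries C, Differential.deriv (HahnSeries.ofPowerSeries ℤ C y) =
      HahnSeries.ofPowerSeries ℤ C (PowerSeries.derivative C y) := by
    intro y
    rw [laurent_deriv_eq]
    ext n
    rw [LaurentSeries.derivative_apply, LaurentSeries.hasseDeriv_coeff]
    -- The case n = -1 is separate: the shifted index is 0, where the series may have a coefficient,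
    -- but the factor n + 1 vanishes.
    rcases lt_trichotomy n (-1) with hn | rfl | hn
    · rw [PowerSeries.coeff_coe, PowerSeries.coeff_coe, if_pos (by omega), if_pos (by omega),
        smul_zero]
    · rw [PowerSeries.coeff_coe (f := PowerSeries.derivative C y)]
      simp
    · lift n to ℕ using by omega
      have hn' : ((n : ℤ) + (1 : ℕ)) = ((n + 1 : ℕ) : ℤ) := by push_cast; rfl
      rw [hn', LaurentSeries.coeff_coe_powerSeries, LaurentSeries.coeff_coe_powerSeries,
        PowerSeries.coeff_derivative, Ring.choose_one_right, zsmul_eq_mul, mul_comm]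
      push_cast
      rfl
  induction n with
  | zero => rfl
  | succ n ih => rw [Function.iterate_succ_apply', Function.iterate_succ_apply', ih, h]

/-- A denominator that does not vanish at 0 is a unit of C[[x]]. -/
theorem exists_powerSeries_of_denom_eval_ne_zero (f : RatFunc C) (hf : f.denom.eval 0 ≠ 0) :
    ∃ a : PowerSeries C, algebraMap (RatFunc C) C⸨X⸩ f = HahnSeries.ofPowerSeries ℤ C a := by
  have hu : PowerSeries.constantCoeff (f.denom : PowerSeries C) ≠ 0 := by
    rwa [← PowerSeries.coeff_zero_eq_constantCoeff_apply, Polynomial.coeff_coe,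
      Polynomial.coeff_zero_eq_eval_zero]
  refine ⟨(f.num : PowerSeries C) * (f.denom : PowerSeries C)⁻¹, ?_⟩
  have hd : algebraMap (RatFunc C) C⸨X⸩ (algebraMap (Polynomial C) (RatFunc C) f.denom) ≠ 0 := by
    simpa using f.denom_ne_zero
  conv_lhs => rw [← RatFunc.num_div_denom f]
  rw [map_div₀, div_eq_iff hd]
  have h1 : ∀ p : Polynomial C, algebraMap (RatFunc C) C⸨X⸩ (algebraMap (Polynomial C) (RatFunc C) p)
      = HahnSeries.ofPowerSeries ℤ C (p : PowerSeries C) := fun p => (RatFunc.coe_coe p).symm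
  rw [h1, h1, ← map_mul, mul_assoc, PowerSeries.inv_mul_cancel _ hu, mul_one]

variable [CharZero C]

/-- Compare coefficients of x^(m-r) for m ≥ r. On the left stands (m-r+1)⋯m times the m-th
coefficient of y, and this factor is invertible in characteristic zero. On the right, i < r means
that only coefficients of index at most m-r+i < m occur. This is a recursion with the first r values
free. -/
theorem exists_powerSeries_solution (r : ℕ) (a : ℕ → PowerSeries C) (c : Fin r → C) :
    ∃ y : PowerSeries C, (∀ i : Fin r, PowerSeries.coeff i y = c i) ∧
      (PowerSeries.derivative C)^[r] y = ∑ i ∈ Finset.range r, a i * (PowerSeries.derivative C)^[i] y := by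
  obtain ⟨y, hy⟩ := exists_seq_of_forall_lt
    (fun m (y : ℕ → C) => if h : m < r then c ⟨m, h⟩ else
      ((m - r + 1).ascFactorial r : C)⁻¹ *
        PowerSeries.coeff (m - r) (∑ i ∈ Finset.range r, a i * (PowerSeries.derivative C)^[i] (PowerSeries.mk y))) (by
    intro m y z hyz
    split_ifs with h
    · rfl
    congr 1
    rw [map_sum, map_sum]
    refine Finset.sum_congr rfl fun i hi => ?_
    rw [PowerSeries.coeff_mul, PowerSeries.coeff_mul]
    refine Finset.sum_congr rfl fun p hp => ?_
    rw [Finset.HasAntidiagonal.mem_antidiagonal] at hp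
    rw [Finset.mem_range] at hi
    rw [PowerSeries.coeff_iterate_derivative, PowerSeries.coeff_iterate_derivative, PowerSeries.coeff_mk, PowerSeries.coeff_mk,
      hyz _ (by omega)])
  refine ⟨PowerSeries.mk y, fun i => ?_, ?_⟩
  · rw [PowerSeries.coeff_mk, hy, dif_pos i.2]
  · ext n
    have h0 : ((n + 1).ascFactorial r : C) ≠ 0 := by
      exact_mod_cast (Nat.ascFactorial_pos n r).ne'
    rw [PowerSeries.coeff_iterate_derivative, PowerSeries.coeff_mk, hy, dif_neg (by omega), Nat.add_sub_cancel,
      mul_inv_cancel_left₀ h0]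

theorem exists_solution_of_isOrdinaryPoint {A : DiffOp (RatFunc C)} (hA : A ≠ 0)
    (h : A.IsOrdinaryPoint 0) (c : Fin A.ord → C) :
    ∃ y : PowerSeries C, (∀ i : Fin A.ord, PowerSeries.coeff i y = c i) ∧
      HahnSeries.ofPowerSeries ℤ C y ∈ A.solutionSpace C⸨X⸩ := by
  have hpole : ∀ i, ∃ a : PowerSeries C, i < A.ord →
      algebraMap (RatFunc C) C⸨X⸩ (A.coeff i / A.coeff A.ord) =
        HahnSeries.ofPowerSeries ℤ C a := by
    intro i
    by_cases hi : i < A.ord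
    · obtain ⟨a, ha⟩ := exists_powerSeries_of_denom_eval_ne_zero (A.coeff i / A.coeff A.ord)
        fun h0 => h ⟨i, hi, h0⟩
      exact ⟨a, fun _ => ha⟩
    · exact ⟨0, fun hi' => absurd hi' hi⟩
  choose a ha using hpole
  -- Dividing A by its leading coefficient and solving for the highest derivative gives the minus
  -- sign.
  obtain ⟨y, hyc, hy⟩ := exists_powerSeries_solution A.ord (fun i => -a i) c
  refine ⟨y, hyc, ?_⟩
  have hlead : A.coeff A.ord ≠ 0 := coeff_ord_ne_zero hA
  have hact : A.act (HahnSeries.ofPowerSeries ℤ C y) = ∑ i ∈ Finset.range (A.ord + 1),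
      algebraMap (RatFunc C) C⸨X⸩ (A.coeff i) *
        (fun g : C⸨X⸩ => Differential.deriv g)^[i] (HahnSeries.ofPowerSeries ℤ C y) :=
    Polynomial.sum_over_range _ (by simp)
  have hterm : ∀ i ∈ Finset.range A.ord, algebraMap (RatFunc C) C⸨X⸩ (A.coeff i) *
        (fun g : C⸨X⸩ => Differential.deriv g)^[i] (HahnSeries.ofPowerSeries ℤ C y) =
      algebraMap (RatFunc C) C⸨X⸩ (A.coeff A.ord) *
        HahnSeries.ofPowerSeries ℤ C (a i * (PowerSeries.derivative C)^[i] y) := by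
    intro i hi
    rw [iterate_deriv_ofPowerSeries, map_mul, ← ha i (Finset.mem_range.1 hi), ← mul_assoc,
      ← map_mul, mul_div_cancel₀ _ hlead]
  change A.act (HahnSeries.ofPowerSeries ℤ C y) = 0
  rw [hact, Finset.sum_range_succ, Finset.sum_congr rfl hterm, ← Finset.mul_sum, ← mul_add,
    iterate_deriv_ofPowerSeries, ← map_sum, ← map_add, hy, ← Finset.sum_add_distrib]
  simp

/-- The first ord A coefficients of a power series solution can be prescribed, so reading them off
is a surjection onto a space of dimension ord A. -/
theorem ord_le_rank_of_isOrdinaryPoint {A : DiffOp (RatFunc C)} (hA : A ≠ 0)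
    (h : A.IsOrdinaryPoint 0) :
    (A.ord : Cardinal) ≤
      Module.rank C ↥(A.solutionSpace C⸨X⸩ ⊓ powerSeriesSubspace C) := by
  let φ : ↥(A.solutionSpace C⸨X⸩ ⊓ powerSeriesSubspace C) →ₗ[C] (Fin A.ord → C) :=
    { toFun := fun f i => f.1.coeff (i : ℕ)
      map_add' := fun f g => rfl
      map_smul' := fun c f => by ext; simp }
  have hφ : Function.Surjective φ := by
    intro c
    obtain ⟨y, hy, hsol⟩ := exists_solution_of_isOrdinaryPoint hA h c
    refine ⟨⟨HahnSeries.ofPowerSeries ℤ C y, hsol, y, rfl⟩, ?_⟩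
    ext i
    exact (LaurentSeries.coeff_coe_powerSeries y i).trans (hy i)
  have hle := LinearMap.lift_rank_le_of_surjective φ hφ
  simpa using hle

end Existence

/-! ### Factors of symmetric products -/

section SymmetricProduct

universe u

variable {C : Type u} [Field C]

/-- Apply the hypothesis in the square-zero extension to f and the generic solution of Q. Their
product is the class of the operator f, so its annihilation by M says that M f lies in the left
ideal of Q. -/
theorem exists_extend_mul_const_eq {L Q M : DiffOp (RatFunc C)} (h : AnnihilatesProducts L Q M)
    {f : C⸨X⸩} (hf : L.act f = 0) :
    ∃ R : DiffOp C⸨X⸩, M.extend C⸨X⸩ * const f = R * Q.extend C⸨X⸩ := by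
  rw [← CyclicModule.smul_gen_eq_zero_iff]
  have hgen := (CyclicModule.smul_gen_eq_zero_iff (Q := Q.extend C⸨X⸩) (Q.extend C⸨X⸩)).2
    ⟨1, (one_mul _).symm⟩
  have hprod := h (TrivSqZeroExt C⸨X⸩ (CyclicModule (Q.extend C⸨X⸩))) (TrivSqZeroExt.inl f)
    (TrivSqZeroExt.inr (CyclicModule.gen _))
    (by rw [CyclicModule.act_inl, hf, TrivSqZeroExt.inl_zero])
    (by rw [CyclicModule.act_inr, hgen, TrivSqZeroExt.inr_zero])
  rw [TrivSqZeroExt.inl_mul_inr, CyclicModule.act_inr, CyclicModule.smul_def, ← mul_smul] at hprod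
  exact TrivSqZeroExt.inr_injective (hprod.trans (TrivSqZeroExt.inr_zero _).symm)

theorem AnnihilatesProducts.mul_left {L Q S : DiffOp (RatFunc C)} (h : AnnihilatesProducts L Q S)
    (R : DiffOp (RatFunc C)) : AnnihilatesProducts L Q (R * S) := by
  intro F _ _ _ _ f g hf hg
  have h0 : R.act (0 : F) = 0 := by
    have h0 := R.act_add_right (0 : F) 0
    simpa using h0
  rw [act_mul, h F f g hf hg, h0]

theorem ker_actLinearMap_extend (A : DiffOp (RatFunc C)) :
    (A.extend C⸨X⸩).actLinearMap.ker = A.solutionSpace C⸨X⸩ := by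
  ext f
  rw [mem_ker_actLinearMap, act_extend]
  rfl

theorem solutionSpace_le_colonSpace {L Q M : DiffOp (RatFunc C)} (h : AnnihilatesProducts L Q M) :
    Q.solutionSpace C⸨X⸩ ≤
      colonSpace (M.solutionSpace C⸨X⸩) (L.solutionSpace C⸨X⸩ : Set C⸨X⸩) := by
  intro g hg f hf
  rw [mul_comm]
  exact h C⸨X⸩ f g hf hg

variable [CharZero C]

theorem rank_solutionSpace_le {A : DiffOp (RatFunc C)} (hA : A ≠ 0) :
    Module.rank C (A.solutionSpace C⸨X⸩) ≤ A.ord := by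
  rw [← ker_actLinearMap_extend, ← ord_extend (K := C⸨X⸩) A]
  exact rank_ker_actLinearMap_le (extend_ne_zero hA)

/-- The power series solutions already have dimension at least ord A, which bounds the dimension of
all Laurent series solutions; so the two spaces coincide. -/
theorem solutionSpace_le_powerSeriesSubspace {A : DiffOp (RatFunc C)} (hA : A ≠ 0)
    (h : A.IsOrdinaryPoint 0) : A.solutionSpace C⸨X⸩ ≤ powerSeriesSubspace C := by
  have hle := rank_solutionSpace_le hA
  have : FiniteDimensional C (A.solutionSpace C⸨X⸩) :=
    Module.rank_lt_aleph0_iff.1 (hle.trans_lt Cardinal.natCast_lt_aleph0)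
  rw [← inf_eq_left]
  refine Submodule.eq_of_le_of_finrank_le inf_le_left ?_
  exact Module.finrank_le_finrank_of_rank_le_rank
    (by simpa using hle.trans (ord_le_rank_of_isOrdinaryPoint hA h))
    ((Submodule.rank_mono inf_le_left).trans_lt (Module.rank_lt_aleph0 _ _))

theorem exists_unit_solution {A : DiffOp (RatFunc C)} (hA : 0 < A.ord) (h : A.IsOrdinaryPoint 0) :
    ∃ y : PowerSeries C, PowerSeries.constantCoeff y ≠ 0 ∧
      HahnSeries.ofPowerSeries ℤ C y ∈ A.solutionSpace C⸨X⸩ := by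
  have hA0 : A ≠ 0 := by rintro rfl; simp [ord] at hA
  -- Only the constant coefficient matters; it is among the prescribed ones because the order is
  -- positive.
  obtain ⟨y, hy, hsol⟩ := exists_solution_of_isOrdinaryPoint hA0 h fun _ => 1
  have h1 : PowerSeries.coeff 0 y = 1 := hy ⟨0, hA⟩
  exact ⟨y, by rw [← PowerSeries.coeff_zero_eq_constantCoeff_apply, h1]; exact one_ne_zero, hsol⟩

theorem rank_solutionSpace_eq_ord {L Q M : DiffOp (RatFunc C)} (h : AnnihilatesProducts L Q M)
    (hL : 0 < L.ord) (hM : M ≠ 0) (hL0 : L.IsOrdinaryPoint 0) (hM0 : M.IsOrdinaryPoint 0) :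
    Module.rank C (Q.solutionSpace C⸨X⸩) = Q.ord := by
  obtain ⟨y, hy, hsol⟩ := exists_unit_solution hL hL0
  have hf : HahnSeries.ofPowerSeries ℤ C y ≠ 0 := fun h0 => hy (by
    rw [HahnSeries.ofPowerSeries_injective (h0.trans (map_zero _).symm), map_zero])
  obtain ⟨R, hR⟩ := exists_extend_mul_const_eq h hsol
  have hM' : M.extend C⸨X⸩ ≠ 0 := extend_ne_zero hM
  have hne := mul_ne_zero hM' (const_ne_zero hf)
  have hR0 : R ≠ 0 := left_ne_zero_of_mul (hR ▸ hne)
  have hQ0 : Q.extend C⸨X⸩ ≠ 0 := right_ne_zero_of_mul (hR ▸ hne)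
  have hQ : Q ≠ 0 := by rintro rfl; exact hQ0 (by simp [extend]; rfl)
  have hord := congrArg ord hR
  rw [ord_mul hM' (const_ne_zero hf), ord_mul hR0 hQ0, ord_const, ord_extend, ord_extend,
    add_zero] at hord
  have hle := rank_solutionSpace_le hQ
  -- ord M ≤ dim V(M) ≤ dim ker R + dim V(Q), to be compared with ord M = ord R + ord Q.
  have hsum := ((ord_le_rank_of_isOrdinaryPoint hM hM0).trans
    (Submodule.rank_mono inf_le_left)).trans
    ((ker_actLinearMap_extend M) ▸ (ker_actLinearMap_extend Q) ▸ rank_ker_le_of_mul_const_eq hf hR)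
  have hsum' := hsum.trans (add_le_add (rank_ker_actLinearMap_le hR0) le_rfl)
  -- The dimension is finite, so ord R can be cancelled among natural numbers.
  obtain ⟨n, hn⟩ := Cardinal.lt_aleph0.1 (hle.trans_lt Cardinal.natCast_lt_aleph0)
  rw [hn] at hle hsum' ⊢
  norm_cast at hle hsum' ⊢
  omega

theorem solutionSpace_factor_le_powerSeriesSubspace {L Q M : DiffOp (RatFunc C)}
    (h : AnnihilatesProducts L Q M) (hL : 0 < L.ord) (hM : M ≠ 0) (hL0 : L.IsOrdinaryPoint 0)
    (hM0 : M.IsOrdinaryPoint 0) : Q.solutionSpace C⸨X⸩ ≤ powerSeriesSubspace C := by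
  obtain ⟨y, hy, hsol⟩ := exists_unit_solution hL hL0
  intro g hg
  -- With f the series of y, the product g f solves M and is therefore a power series z; as y is a
  -- unit, g = z / y.
  obtain ⟨z, hz⟩ := solutionSpace_le_powerSeriesSubspace hM hM0
    (solutionSpace_le_colonSpace h hg _ hsol)
  refine ⟨z * y⁻¹, ?_⟩
  rw [map_mul, hz, mul_assoc, ← map_mul, PowerSeries.mul_inv_cancel _ hy, map_one, mul_one]

end SymmetricProduct

end DiffOp

/-! ### Solutions at an ordinary point and the colon space -/

theorem mainTheorem4 {C : Type*} [Field C] [IsAlgClosed C] [CharZero C]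
    (L M Q S : DiffOp (RatFunc C))
    (hL : 0 < L.ord) (hM : 0 < M.ord)
    (hS : DiffOp.IsSymmetricProduct L Q S) (hSM : S.IsRightFactor M)
    (hL0 : L.IsOrdinaryPoint 0) (hM0 : M.IsOrdinaryPoint 0) :
    (Q.IsOrdinaryPoint 0 ∨ Q.IsApparentSingularityAtZero) ∧
    Q.solutionSpace C⸨X⸩ ≤
      DiffOp.colonSpace (M.solutionSpace C⸨X⸩) (L.solutionSpace C⸨X⸩ : Set C⸨X⸩) ∧
    (Q.ord : Cardinal) = Module.rank C (Q.solutionSpace C⸨X⸩) ∧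
    Module.rank C (Q.solutionSpace C⸨X⸩) ≤
      Module.rank C
        (DiffOp.colonSpace (M.solutionSpace C⸨X⸩) (L.solutionSpace C⸨X⸩ : Set C⸨X⸩)) := by
  have hM' : M ≠ 0 := by rintro rfl; simp [DiffOp.ord] at hM
  have hann : DiffOp.AnnihilatesProducts L Q M := by
    obtain ⟨R, rfl⟩ := hSM
    exact hS.annihilates.mul_left R
  have hrank := DiffOp.rank_solutionSpace_eq_ord hann hL hM' hL0 hM0
  refine ⟨?_, DiffOp.solutionSpace_le_colonSpace hann, hrank.symm,
    Submodule.rank_mono (DiffOp.solutionSpace_le_colonSpace hann)⟩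
  by_cases h : Q.IsSingularity 0
  · refine Or.inr ⟨h, ?_⟩
    -- All Laurent series solutions of Q are power series, so the space in the definition of an
    -- apparent singularity is V(Q) itself.
    rw [inf_eq_left.2
      (DiffOp.solutionSpace_factor_le_powerSeriesSubspace hann hL hM' hL0 hM0), hrank]
  · exact Or.inl h
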